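/- Let $d\ge 0$ be an integer. For $z=(x,\omega)\in\mathbb{R}^{2d}$ let $\pi(z)$ be the time-frequency shift on $L^2(\mathbb{R}^d)$, $\pi(z)f(t)=e^{2\pi i t\cdot\omega}f(t-x)$, and for a bounded operator $S$ on $L^2(\mathbb{R}^d)$ let $\alpha_z(S)=\pi(z)S\pi(z)^*$ and $\check S=PSP$, where $Pf(t)=f(-t)$. For trace class operators $S,T$ put $S\star T(z)=\operatorname{tr}(S\,\alpha_z(\check T))$, and let $\tilde S=S\star\check S$ be the total correlation function. For compact $\Omega\subset\mathbb{R}^{2d}$ with Lebesgue measure $|\Omega|$, let $$\chi_\Omega\star S=\int_\Omega \alpha_z(S)\,dz$$ (a Bochner integral in the operator norm) be the mixed-state localization operator. Write $P(A)=\operatorname{tr}(A)-\operatorname{tr}(A^2)$ for the projection functional, $\Omega-z=\{w-z: w\in\Omega\}$, and, if $|\Omega|>0$, $$\mathrm{ALC}(\tilde S,\Omega)=\frac1{|\Omega|}\int_\Omega\Big(1-\int_{\Omega-z}\tilde S(z')\,dz'\Big)\,dz$$ for the average lack of concentration. Proposition. Let $\Omega\subset\mathbb{R}^{2d}$ be compact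 and let $S$ be a positive trace class operator on $L^2(\mathbb{R}^d)$ with $\operatorname{tr}(S)=1$. Then $z\mapsto\alpha_z(S)$ is Bochner integrable on $\Omega$, the operators $\chi_\Omega\star S$ and $(\chi_\Omega\star S)^2$ are trace class, $\tilde S$ is integrable on $\Omega-z$ for every $z\in\mathbb{R}^{2d}$, the function $z\mapsto 1-\int_{\Omega-z}\tilde S(z')\,dz'$ is integrable on $\Omega$, and $$P(\chi_\Omega\star S)=\int_{\Omega}\Big(1-\int_{\Omega-z}\tilde S(z')\,dz'\Big)\,dz.$$ Consequently, if $|\Omega|>0$, then $\mathrm{ALC}(\tilde S,\Omega)=P(\chi_\Omega\star S)/|\Omega|$. -/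

import Mathlib

noncomputable section

open MeasureTheory

namespace QHA

/-! ### Trace class operators and the trace -/

/-- `T` is trace class: `∑ᵢ ⟨eᵢ, |T| eᵢ⟩ < ∞` for every orthonormal basis `(eᵢ)`, where
`|T| = (T* T)^{1/2}`. -/
def IsTraceClass.{u} {H : Type u} [NormedAddCommGroup H] [InnerProductSpace ℂ H] [CompleteSpace H]
    (T : H →L[ℂ] H) : Prop :=
  ∀ (ι : Type u) (e : HilbertBasis ι ℂ H), Summable fun i => inner ℂ (e i) (CFC.abs T (e i))

/-- The index set of a fixed orthonormal basis of `H`. -/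
def basisIndex.{u} (H : Type u) [NormedAddCommGroup H] [InnerProductSpace ℂ H]
    [CompleteSpace H] : Set H :=
  (exists_hilbertBasis ℂ H).choose

/-- A fixed orthonormal basis of `H`. -/
def stdBasis.{u} (H : Type u) [NormedAddCommGroup H] [InnerProductSpace ℂ H]
    [CompleteSpace H] : HilbertBasis (basisIndex H) ℂ H :=
  (exists_hilbertBasis ℂ H).choose_spec.choose

/-- The trace `tr T = ∑ᵢ ⟨eᵢ, T eᵢ⟩`, computed in a fixed orthonormal basis; for trace class `T`
the sum converges absolutely and does not depend on the basis. The inner product `inner ℂ x y` is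
linear in `y`. -/
def tr.{u} {H : Type u} [NormedAddCommGroup H] [InnerProductSpace ℂ H] [CompleteSpace H]
    (T : H →L[ℂ] H) : ℂ :=
  ∑' i, inner ℂ (stdBasis H i) (T (stdBasis H i))

/-! ### Phase space and time-frequency shifts -/

/-- `ℝ^d`. -/
abbrev Space (d : ℕ) : Type := EuclideanSpace ℝ (Fin d)

/-- The phase space `ℝ^{2d} = ℝ^d × ℝ^d` with Lebesgue measure; its points are `z = (x, ω)`. -/
abbrev Phase (d : ℕ) : Type := Space d × Space d

/-- `L²(ℝ^d)` with complex values. -/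
abbrev L2 (d : ℕ) : Type := Lp ℂ 2 (volume : Measure (Space d))

/-- The character `t ↦ e^{2πi t·ω}`. -/
def char {d : ℕ} (ω t : Space d) : ℂ :=
  Complex.exp (2 * Real.pi * Complex.I * ((inner ℝ t ω : ℝ) : ℂ))

theorem norm_char {d : ℕ} (ω t : Space d) : ‖char ω t‖ = 1 := by
  have h : 2 * (Real.pi : ℂ) * Complex.I * ((inner ℝ t ω : ℝ) : ℂ)
      = ((2 * Real.pi * inner ℝ t ω : ℝ) : ℂ) * Complex.I := by
    push_cast; ring
  rw [char, h, Complex.norm_exp_ofReal_mul_I]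

theorem continuous_char {d : ℕ} (ω : Space d) : Continuous (char ω) := by
  unfold char; fun_prop

theorem memLp_char_mul {d : ℕ} (ω : Space d) (f : L2 d) :
    MemLp (fun t => char ω t * f t) 2 (volume : Measure (Space d)) :=
  (Lp.memLp f).of_le ((continuous_char ω).aestronglyMeasurable.mul (Lp.memLp f).1)
    (Filter.Eventually.of_forall fun t => by simp [norm_char])

/-- Modulation: `(modulation ω f)(t) = e^{2πi t·ω} f(t)`. -/
def modulation {d : ℕ} (ω : Space d) : L2 d →ₗᵢ[ℂ] L2 d where
  toFun f := (memLp_char_mul ω f).toLp _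
  map_add' f g := by
    rw [← MemLp.toLp_add, MemLp.toLp_eq_toLp_iff]
    filter_upwards [Lp.coeFn_add f g] with t ht
    simp only [Pi.add_apply] at ht ⊢
    rw [ht, mul_add]
  map_smul' c f := by
    rw [RingHom.id_apply, ← MemLp.toLp_const_smul, MemLp.toLp_eq_toLp_iff]
    filter_upwards [Lp.coeFn_smul c f] with t ht
    simp [ht, mul_left_comm]
  norm_map' f := by
    change ‖(memLp_char_mul ω f).toLp _‖ = ‖f‖
    rw [Lp.norm_toLp, Lp.norm_def]
    congr 1
    exact eLpNorm_congr_norm_ae (Filter.Eventually.of_forall fun t => by simp [norm_char])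

/-- Translation: `(translation x f)(t) = f(t - x)`. -/
def translation {d : ℕ} (x : Space d) : L2 d →ₗᵢ[ℂ] L2 d :=
  Lp.compMeasurePreservingₗᵢ ℂ (fun t => t - x) (measurePreserving_sub_right volume x)

/-- The time-frequency shift `π(z)`, `z = (x, ω)`: `(π(z) f)(t) = e^{2πi t·ω} f(t - x)`. -/
def tfShift {d : ℕ} (z : Phase d) : L2 d →L[ℂ] L2 d :=
  ((modulation z.2).comp (translation z.1)).toContinuousLinearMap

/-- The pointwise formula for `π(z) f`. -/
theorem tfShift_coeFn {d : ℕ} (z : Phase d) (f : L2 d) :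
    tfShift z f =ᵐ[volume] fun t => char z.2 t * f (t - z.1) := by
  have h1 : tfShift z f =ᵐ[volume] fun t => char z.2 t * translation z.1 f t :=
    MemLp.coeFn_toLp (memLp_char_mul z.2 (translation z.1 f))
  have h2 : translation z.1 f =ᵐ[volume] fun t => f (t - z.1) :=
    Lp.coeFn_compMeasurePreserving f (measurePreserving_sub_right volume z.1)
  filter_upwards [h1, h2] with t ht1 ht2
  rw [ht1, ht2]

/-- The parity operator: `(P f)(t) = f(-t)`. -/
def parity (d : ℕ) : L2 d →L[ℂ] L2 d :=
  (Lp.compMeasurePreservingₗᵢ ℂ (fun t : Space d => -t)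
    (Measure.measurePreserving_neg volume)).toContinuousLinearMap

/-- The pointwise formula for `P f`. -/
theorem parity_coeFn {d : ℕ} (f : L2 d) :
    parity d f =ᵐ[volume] fun t => f (-t) :=
  Lp.coeFn_compMeasurePreserving f (Measure.measurePreserving_neg volume)

/-! ### Convolutions of operators and functions -/

/-- The shift `α_z(S) = π(z) S π(z)*` of an operator. -/
def opShift {d : ℕ} (z : Phase d) (S : L2 d →L[ℂ] L2 d) : L2 d →L[ℂ] L2 d :=
  tfShift z ∘L S ∘L ContinuousLinearMap.adjoint (tfShift z)

/-- `Š = P S P`. -/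
def check {d : ℕ} (S : L2 d →L[ℂ] L2 d) : L2 d →L[ℂ] L2 d :=
  parity d ∘L S ∘L parity d

/-- The convolution `f ⋆ S = ∫ f(z) α_z(S) dz` of a function and an operator (Bochner integral). -/
def funConv {d : ℕ} (f : Phase d → ℂ) (S : L2 d →L[ℂ] L2 d) : L2 d →L[ℂ] L2 d :=
  ∫ z, f z • opShift z S

/-- The convolution `(S ⋆ T)(z) = tr(S α_z(Ť))` of two operators. -/
def opConv {d : ℕ} (S T : L2 d →L[ℂ] L2 d) (z : Phase d) : ℂ :=
  tr (S ∘L opShift z (check T))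

/-- The total correlation function `S̃ = S ⋆ Š`. -/
def totalCorr {d : ℕ} (S : L2 d →L[ℂ] L2 d) : Phase d → ℂ :=
  opConv S (check S)

/-- The mixed-state localization operator `χ_Ω ⋆ S` (without normalization). -/
def locOp {d : ℕ} (Ω : Set (Phase d)) (S : L2 d →L[ℂ] L2 d) : L2 d →L[ℂ] L2 d :=
  funConv (Ω.indicator fun _ => 1) S

/-! ### Projection functional and average lack of concentration -/

/-- The projection functional `P(A) = tr A - tr A²`. -/
def projFunctional {d : ℕ} (A : L2 d →L[ℂ] L2 d) : ℂ :=
  tr A - tr (A ∘L A)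

/-- The translated set `Ω - z`. -/
def shiftSet {d : ℕ} (Ω : Set (Phase d)) (z : Phase d) : Set (Phase d) :=
  (fun w => w - z) '' Ω

/-- The lack of concentration `1 - ∫_{Ω - z} F(z') dz'` of `F` in `Ω - z`. -/
def lackConc {d : ℕ} (F : Phase d → ℂ) (Ω : Set (Phase d)) (z : Phase d) : ℂ :=
  1 - ∫ z' in shiftSet Ω z, F z'

/-- The average lack of concentration
`ALC(F, Ω) = |Ω|⁻¹ ∫_Ω (1 - ∫_{Ω - z} F(z') dz') dz`. -/
def ALC {d : ℕ} (F : Phase d → ℂ) (Ω : Set (Phase d)) : ℂ :=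
  (1 / (volume.real Ω : ℂ)) * ∫ z in Ω, lackConc F Ω z

end QHA

end

open MeasureTheory QHA

namespace QHA

/-! ### Positive trace class operators as sums of rank-one operators, and their traces. -/

section TraceClass

open InnerProductSpace ContinuousLinearMap

/-! With `g j = √S (e j)`, a positive trace class `S` is the norm-convergent sum `∑ⱼ gⱼ ⊗ gⱼ*`,
where `∑ⱼ ‖gⱼ‖² < ∞` (`exists_rankOne_decomposition`). Hence `tr (T S) = ∑ⱼ ⟨gⱼ, T gⱼ⟩` for every
bounded `T`, whatever basis computes the trace (`hasSum_inner_comp`), and traces pass through the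
integral defining `χ_Ω ⋆ S` (`hasSum_inner_comp_locOp`, `tr_integral_comp`). So `tr (χ_Ω ⋆ S) = |Ω|
tr S`, and covariance, `tr (α_z(S) α_w(S)) = S̃(w - z)`, turns `tr ((χ_Ω ⋆ S)²)` into the double
integral of `S̃(w - z)` over `Ω × Ω`. Translating the inner integral to `Ω - z` and subtracting
gives the formula. Both operators are positive, so each is its own absolute value and summability of
its diagonal in every basis makes it trace class. The integrability claims follow from continuity on
compact sets. -/

theorem countable_of_orthonormal {H : Type*} [NormedAddCommGroup H] [InnerProductSpace ℂ H]
    [TopologicalSpace.SeparableSpace H] {ι : Type*} {v : ι → H}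
    (hv : Orthonormal ℂ v) : Countable ι := by
  have hdist : ∀ i j, i ≠ j → 1 < dist (v i) (v j) := by
    intro i j hij
    have h : ‖v i - v j‖ * ‖v i - v j‖ = 2 := by
      rw [norm_sub_mul_self (𝕜 := ℂ), hv.2 hij, hv.1 i, hv.1 j]
      norm_num
    rw [dist_eq_norm]
    nlinarith [norm_nonneg (v i - v j)]
  have hdisj : Pairwise (Function.onFun Disjoint fun i => Metric.ball (v i) (1 / 2)) := by
    intro i j hij
    apply Metric.ball_disjoint_ball
    linarith [hdist i j hij]
  exact Pairwise.countable_of_isOpen_disjoint hdisj (fun _ => Metric.isOpen_ball)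
    fun i => Metric.nonempty_ball.2 (by norm_num)

/-- Exchange of the order of summation. -/
theorem hasSum_exchange {ι κ : Type*} {F : ι → κ → ℂ} {a : ι → ℝ} {c : κ → ℂ} {r : ι → ℂ}
    (hrow : ∀ j, Summable fun i => ‖F j i‖) (hle : ∀ j, ∑' i, ‖F j i‖ ≤ a j) (ha : Summable a)
    (hc : ∀ i, HasSum (fun j => F j i) (c i)) (hr : ∀ j, HasSum (F j) (r j)) :
    HasSum c (∑' j, r j) ∧ ∀ s : Finset κ, ∑ i ∈ s, ‖c i‖ ≤ ∑' j, a j := by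
  have hcol : Summable fun j => ∑' i, ‖F j i‖ :=
    ha.of_nonneg_of_le (fun _ => tsum_nonneg fun _ => norm_nonneg _) hle
  have hsumN : Summable fun p : ι × κ => ‖F p.1 p.2‖ :=
    (summable_prod_of_nonneg fun _ => norm_nonneg _).2 ⟨hrow, hcol⟩
  have hswapN : Summable fun q : κ × ι => ‖F q.2 q.1‖ := hsumN.prod_symm
  have hsum : Summable fun p : ι × κ => F p.1 p.2 := hsumN.of_norm
  have hcol' : ∀ i, Summable fun j => ‖F j i‖ := fun i => hswapN.prod_factor i
  constructor
  · have h1 := hswapN.of_norm.hasSum.prod_fiberwise hc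
    have h2 : ∑' q : κ × ι, F q.2 q.1 = ∑' j, r j :=
      ((Equiv.prodComm κ ι).tsum_eq fun p : ι × κ => F p.1 p.2).trans
        (hsum.hasSum.prod_fiberwise hr).tsum_eq.symm
    rwa [h2] at h1
  · intro s
    calc ∑ i ∈ s, ‖c i‖ ≤ ∑ i ∈ s, ∑' j, ‖F j i‖ := Finset.sum_le_sum fun i _ => by
          rw [← (hc i).tsum_eq]
          exact norm_tsum_le_tsum_norm (hcol' i)
      _ ≤ ∑' i, ∑' j, ‖F j i‖ :=
          hswapN.prod.sum_le_tsum s fun _ _ => tsum_nonneg fun _ => norm_nonneg _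
      _ = ∑' j, ∑' i, ‖F j i‖ := hsumN.tsum_comm
      _ ≤ ∑' j, a j := hcol.tsum_le_tsum hle ha

variable {H : Type*} [NormedAddCommGroup H] [InnerProductSpace ℂ H]

theorem re_inner_self_eq_norm_sq (x : H) : (inner ℂ x x).re = ‖x‖ ^ 2 := by
  rw [inner_self_eq_norm_sq_to_K]; norm_cast

/-- Parseval's identity for a Hilbert basis. -/
theorem hasSum_norm_sq_inner {ι : Type*} (b : HilbertBasis ι ℂ H) (x : H) :
    HasSum (fun i => ‖inner ℂ (b i) x‖ ^ 2) (‖x‖ ^ 2) := by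
  have h := Complex.hasSum_re (b.hasSum_inner_mul_inner x x)
  rw [re_inner_self_eq_norm_sq] at h
  refine h.congr_fun fun i => ?_
  rw [← inner_conj_symm x, ← Complex.normSq_eq_conj_mul_self, Complex.ofReal_re,
    Complex.normSq_eq_norm_sq]

theorem norm_inner_apply_le (T : H →L[ℂ] H) (x : H) : ‖inner ℂ x (T x)‖ ≤ ‖T‖ * ‖x‖ ^ 2 := by
  calc _ ≤ ‖x‖ * ‖T x‖ := norm_inner_le_norm _ _
    _ ≤ ‖x‖ * (‖T‖ * ‖x‖) := by gcongr; exact T.le_opNorm x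
    _ = _ := by ring

/-- The trace of `T S` for `S = ∑ⱼ gⱼ ⊗ gⱼ*`. -/
theorem hasSum_inner_comp {ι κ : Type*} (b : HilbertBasis κ ℂ H) {g : ι → H}
    (hg : Summable fun j => ‖g j‖ ^ 2) {S : H →L[ℂ] H}
    (hS : HasSum (fun j => rankOne ℂ (g j) (g j)) S) (T : H →L[ℂ] H) :
    HasSum (fun i => inner ℂ (b i) (T (S (b i)))) (∑' j, inner ℂ (g j) (T (g j))) ∧
    ∀ s : Finset κ, ∑ i ∈ s, ‖inner ℂ (b i) (T (S (b i)))‖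
      ≤ ∑' j, (‖T‖ ^ 2 + 1) / 2 * ‖g j‖ ^ 2 := by
  -- The arithmetic-geometric mean inequality leaves squares, which Parseval sums over `i`; the
  -- constant `(‖T‖ ^ 2 + 1) / 2` comes from here.
  have hFle : ∀ j i, ‖inner ℂ (g j) (b i) * inner ℂ (b i) (T (g j))‖
      ≤ (‖inner ℂ (b i) (T (g j))‖ ^ 2 + ‖inner ℂ (b i) (g j)‖ ^ 2) / 2 := by
    intro j i
    rw [norm_mul, norm_inner_symm (g j)]
    linarith [two_mul_le_add_sq ‖inner ℂ (b i) (T (g j))‖ ‖inner ℂ (b i) (g j)‖]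
  have hbd : ∀ j, HasSum (fun i => (‖inner ℂ (b i) (T (g j))‖ ^ 2 + ‖inner ℂ (b i) (g j)‖ ^ 2) / 2)
      ((‖T (g j)‖ ^ 2 + ‖g j‖ ^ 2) / 2) := fun j =>
    ((hasSum_norm_sq_inner b _).add (hasSum_norm_sq_inner b _)).div_const 2
  have hbd' : ∀ j, (‖T (g j)‖ ^ 2 + ‖g j‖ ^ 2) / 2 ≤ (‖T‖ ^ 2 + 1) / 2 * ‖g j‖ ^ 2 := fun j => by
    have := pow_le_pow_left₀ (norm_nonneg _) (T.le_opNorm (g j)) 2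
    rw [mul_pow] at this
    linarith
  have hrow := fun j => (hbd j).summable.of_nonneg_of_le (fun _ => norm_nonneg _) (hFle j)
  refine hasSum_exchange (F := fun j i => inner ℂ (g j) (b i) * inner ℂ (b i) (T (g j)))
    hrow (fun j => ?_) (hg.mul_left _) (fun i => ?_) fun j => b.hasSum_inner_mul_inner _ _
  · exact (((hrow j).tsum_le_tsum (hFle j) (hbd j).summable).trans_eq (hbd j).tsum_eq).trans
      (hbd' j)
  · have h := (hS.mapL (ContinuousLinearMap.apply ℂ H (b i))).mapL ((innerSL ℂ (b i)).comp T)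
    exact h.congr_fun fun j => by simp

variable [CompleteSpace H]

/-- A positive trace class operator is a sum `∑ⱼ gⱼ ⊗ gⱼ*` with `∑ⱼ ‖gⱼ‖² < ∞`. -/
theorem exists_rankOne_decomposition {S : H →L[ℂ] H} (hpos : S.IsPositive)
    (hS : IsTraceClass S) :
    ∃ g : basisIndex H → H, Summable (fun j => ‖g j‖ ^ 2) ∧
      HasSum (fun j => rankOne ℂ (g j) (g j)) S := by
  have h0 : 0 ≤ S := (nonneg_iff_isPositive S).2 hpos
  set R := CFC.sqrt S with hR
  have hRR : ∀ x, R (R x) = S x := fun x => by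
    exact DFunLike.congr_fun (CFC.sqrt_mul_sqrt_self S h0) x
  have hRsa : ∀ x y, inner ℂ (R x) y = inner ℂ x (R y) :=
    ((nonneg_iff_isPositive R).1 (CFC.sqrt_nonneg S)).isSymmetric
  have habs : CFC.abs S = S := CFC.abs_of_nonneg S h0
  have key : ∀ j, inner ℂ (stdBasis H j) (S (stdBasis H j))
      = (‖R (stdBasis H j)‖ : ℂ) ^ 2 := fun j => by
    rw [← hRR, ← hRsa, inner_self_eq_norm_sq_to_K]; rfl
  have hsum := hS _ (stdBasis H)
  simp only [habs, key] at hsum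
  have hsum' : Summable fun j => ‖R (stdBasis H j)‖ ^ 2 := by exact_mod_cast hsum
  refine ⟨fun j => R (stdBasis H j), hsum', ?_⟩
  have h1 : Summable fun j => rankOne ℂ (R (stdBasis H j)) (R (stdBasis H j)) :=
    .of_norm (by simpa [← pow_two] using hsum')
  -- Apply `R` to the basis expansion of `R x` and use `R (R x) = S x`.
  have h2 : ∑' j, rankOne ℂ (R (stdBasis H j)) (R (stdBasis H j)) = S := by
    ext x
    have h3 := ((stdBasis H).hasSum_repr (R x)).mapL R
    have h4 := h1.hasSum.mapL (ContinuousLinearMap.apply ℂ H x)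
    rw [hRR] at h3
    refine h4.unique (h3.congr_fun fun j => ?_)
    simp [HilbertBasis.repr_apply_apply, hRsa]
  exact h2 ▸ h1.hasSum

theorem tr_comp_eq_tsum {ι : Type*} {g : ι → H}
    (hg : Summable fun j => ‖g j‖ ^ 2) {S : H →L[ℂ] H}
    (hS : HasSum (fun j => rankOne ℂ (g j) (g j)) S) (T : H →L[ℂ] H) :
    tr (T ∘L S) = ∑' j, inner ℂ (g j) (T (g j)) :=
  (hasSum_inner_comp (stdBasis H) hg hS T).1.tsum_eq

theorem isTraceClass_of_isPositive.{u} {H : Type u} [NormedAddCommGroup H]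
    [InnerProductSpace ℂ H] [CompleteSpace H] {A : H →L[ℂ] H} (hA : A.IsPositive)
    (h : ∀ (ι : Type u) (e : HilbertBasis ι ℂ H), Summable fun i => inner ℂ (e i) (A (e i))) :
    IsTraceClass A := by
  intro ι e
  rw [CFC.abs_of_nonneg A ((nonneg_iff_isPositive A).2 hA)]
  exact h ι e

end TraceClass

/-! ### Time-frequency shifts, localization operators and the total correlation function. -/

section TimeFrequency

open InnerProductSpace ContinuousLinearMap

variable {d : ℕ}

theorem modulation_coeFn (ω : Space d) (f : L2 d) :
    modulation ω f =ᵐ[volume] fun t => char ω t * f t :=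
  MemLp.coeFn_toLp (memLp_char_mul ω f)

theorem char_add (ω ω' t : Space d) : char (ω + ω') t = char ω t * char ω' t := by
  simp only [char, inner_add_right, Complex.ofReal_add, mul_add, Complex.exp_add]

theorem char_add_right (ω s t : Space d) : char ω (s + t) = char ω s * char ω t := by
  simp only [char, inner_add_left, Complex.ofReal_add, mul_add, Complex.exp_add]

/-- For an isometric family, the squared distance is `2‖f‖²` minus twice the real part of an inner
product, which is continuous by dominated convergence with bound `‖f t‖ ^ 2`. -/
theorem continuous_modulation (f : L2 d) : Continuous fun ω : Space d => modulation ω f := by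
  have hsq : Integrable (fun t => ‖f t‖ ^ 2) (volume : Measure (Space d)) :=
    (memLp_two_iff_integrable_sq_norm (Lp.memLp f).1).1 (Lp.memLp f)
  have hinner : ∀ ω ω' : Space d, inner ℂ (modulation ω f) (modulation ω' f)
      = ∫ t, inner ℂ (char ω t * f t) (char ω' t * f t) := fun ω ω' => by
    rw [L2.inner_def]
    refine integral_congr_ae ?_
    filter_upwards [modulation_coeFn ω f, modulation_coeFn ω' f] with t h h'
    rw [h, h']
  have hcont : ∀ ω : Space d, Continuous fun ω' => inner ℂ (modulation ω f) (modulation ω' f) := by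
    intro ω
    simp only [hinner]
    refine continuous_of_dominated (bound := fun t => ‖f t‖ ^ 2) (fun ω' => ?_) (fun ω' => ?_)
      hsq ?_
    · exact (memLp_char_mul ω f).1.inner (memLp_char_mul ω' f).1
    · refine .of_forall fun t => (norm_inner_le_norm _ _).trans_eq ?_
      rw [norm_mul, norm_mul, norm_char, norm_char, one_mul, pow_two]
    · refine .of_forall fun t => ?_
      unfold char
      fun_prop
  rw [continuous_iff_continuousAt]
  intro ω
  rw [ContinuousAt, tendsto_iff_norm_sub_tendsto_zero]
  have hsub : ∀ ω', ‖modulation ω' f - modulation ω f‖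
      = √(2 * ‖f‖ ^ 2 - 2 * (inner ℂ (modulation ω f) (modulation ω' f)).re) := fun ω' => by
    rw [norm_sub_rev, ← Real.sqrt_sq (norm_nonneg (modulation ω f - modulation ω' f)),
      norm_sub_sq (𝕜 := ℂ), LinearIsometry.norm_map, LinearIsometry.norm_map]
    congr 1
    simp only [RCLike.re_to_complex]
    ring
  simp only [hsub]
  have hc : Continuous fun ω' =>
      √(2 * ‖f‖ ^ 2 - 2 * (inner ℂ (modulation ω f) (modulation ω' f)).re) :=
    (continuous_const.sub (continuous_const.mul
      (Complex.continuous_re.comp (hcont ω)))).sqrt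
  convert hc.tendsto ω
  rw [re_inner_self_eq_norm_sq, LinearIsometry.norm_map, sub_self, Real.sqrt_zero]

theorem continuous_translation (f : L2 d) : Continuous fun x : Space d => translation x f := by
  have hg : Continuous fun x : Space d => (⟨fun t => t - x, by fun_prop⟩ : C(Space d, Space d)) :=
    ContinuousMap.continuous_of_continuous_uncurry _
      (by simp only [Function.uncurry_def, ContinuousMap.coe_mk]; fun_prop)
  exact (continuous_const (y := f)).compMeasurePreservingLp hg
    (fun x => measurePreserving_sub_right volume x) (by norm_num)

theorem continuous_tfShift_apply (f : L2 d) : Continuous fun z : Phase d => tfShift z f := by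
  -- Modulations are uniformly 1-Lipschitz, so separate continuity upgrades to joint continuity.
  have h : Continuous (fun p : L2 d × Space d => modulation p.2 p.1 : L2 d × Space d → L2 d) :=
    continuous_prod_of_continuous_lipschitzWith (fun p : L2 d × Space d => modulation p.2 p.1) 1
      continuous_modulation fun ω => (modulation ω).lipschitz
  have h' : Continuous fun z : Phase d => (translation z.1 f, z.2) :=
    ((continuous_translation f).comp continuous_fst).prodMk continuous_snd
  change Continuous fun z : Phase d => modulation z.2 (translation z.1 f)
  have h'' := h.comp h'
  exact h''

theorem norm_tfShift_apply (z : Phase d) (f : L2 d) : ‖tfShift z f‖ = ‖f‖ :=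
  ((modulation z.2).comp (translation z.1)).norm_map f

theorem inner_tfShift_tfShift (z : Phase d) (f g : L2 d) :
    inner ℂ (tfShift z f) (tfShift z g) = inner ℂ f g :=
  ((modulation z.2).comp (translation z.1)).inner_map_map f g

theorem adjoint_tfShift_tfShift (z : Phase d) (f : L2 d) :
    adjoint (tfShift z) (tfShift z f) = f :=
  ext_inner_left ℂ fun v => by rw [adjoint_inner_right, inner_tfShift_tfShift]

/-- Time-frequency shifts form a projective representation. -/
theorem tfShift_tfShift (z u : Phase d) (f : L2 d) :
    tfShift z (tfShift u f) = char u.2 (-z.1) • tfShift (z + u) f := by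
  refine Lp.ext ?_
  have h := (measurePreserving_sub_right volume z.1).quasiMeasurePreserving.ae_eq_comp
    (tfShift_coeFn u f)
  filter_upwards [tfShift_coeFn z (tfShift u f), h, tfShift_coeFn (z + u) f,
    Lp.coeFn_smul (char u.2 (-z.1)) (tfShift (z + u) f)] with t h1 h2 h3 h4
  simp only [Function.comp_apply] at h2
  rw [h1, h2, h4, Pi.smul_apply, h3, Prod.snd_add, Prod.fst_add, char_add, sub_eq_add_neg t,
    char_add_right, smul_eq_mul, ← sub_eq_add_neg, sub_sub]
  ring

/-- Up to a unimodular phase, `π(w)` is `π(z) π(w - z)`, and a quadratic form does not see the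
phase. -/
theorem inner_tfShift_opShift (z w : Phase d) (S : L2 d →L[ℂ] L2 d) (f : L2 d) :
    inner ℂ (tfShift w f) (opShift z S (tfShift w f))
      = inner ℂ (tfShift (w - z) f) (S (tfShift (w - z) f)) := by
  have hc := norm_char (w - z).2 (-z.1)
  obtain ⟨c, hc', h⟩ : ∃ c : ℂ, ‖c‖ = 1 ∧ tfShift w f = c • tfShift z (tfShift (w - z) f) := by
    refine ⟨(char (w - z).2 (-z.1))⁻¹, by rw [norm_inv, hc, inv_one], ?_⟩
    rw [tfShift_tfShift, add_sub_cancel, inv_smul_smul₀]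
    exact norm_ne_zero_iff.1 (by rw [hc]; exact one_ne_zero)
  have hcc : (starRingEnd ℂ) c * c = 1 := by
    rw [← Complex.normSq_eq_conj_mul_self, Complex.normSq_eq_norm_sq, hc']; norm_num
  simp only [h, opShift, comp_apply, map_smul, adjoint_tfShift_tfShift, inner_smul_left,
    inner_smul_right, inner_tfShift_tfShift]
  rw [← mul_assoc, mul_comm c, hcc, one_mul]

theorem parity_parity (f : L2 d) : parity d (parity d f) = f := by
  refine Lp.ext ?_
  have h := (Measure.measurePreserving_neg (volume : Measure (Space d))).quasiMeasurePreserving.ae_eq_comp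
    (parity_coeFn f)
  filter_upwards [parity_coeFn (parity d f), h] with t h1 h2
  simp only [Function.comp_apply, neg_neg] at h2
  rw [h1, h2]

theorem check_check (S : L2 d →L[ℂ] L2 d) : check (check S) = S := by
  ext1 f
  simp only [check, comp_apply, parity_parity]

theorem opShift_isPositive (z : Phase d) {S : L2 d →L[ℂ] L2 d} (hS : S.IsPositive) :
    (opShift z S).IsPositive :=
  hS.conj_adjoint (tfShift z)

theorem opShift_rankOne (z : Phase d) (f g : L2 d) :
    opShift z (rankOne ℂ f g) = rankOne ℂ (tfShift z f) (tfShift z g) := by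
  ext1 h
  simp [opShift, adjoint_inner_right]

theorem hasSum_opShift (z : Phase d) {ι : Type*} {g : ι → L2 d} {S : L2 d →L[ℂ] L2 d}
    (hS : HasSum (fun j => rankOne ℂ (g j) (g j)) S) :
    HasSum (fun j => rankOne ℂ (tfShift z (g j)) (tfShift z (g j))) (opShift z S) := by
  have h := (hS.mapL ((compL ℂ (L2 d) (L2 d) (L2 d)).flip (adjoint (tfShift z)))).mapL
    (compL ℂ (L2 d) (L2 d) (L2 d) (tfShift z))
  exact h.congr_fun fun j => (opShift_rankOne z (g j) (g j)).symm

theorem summable_norm_sq_tfShift (z : Phase d) {ι : Type*} {g : ι → L2 d}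
    (hg : Summable fun j => ‖g j‖ ^ 2) : Summable fun j => ‖tfShift z (g j)‖ ^ 2 := by
  simpa only [norm_tfShift_apply] using hg

/-- Strong continuity of `π` makes each rank-one term norm continuous, and the bounds `‖gⱼ‖²` are
independent of `z`, so the Weierstrass test applies. This yields Bochner integrability in operator
norm. -/
theorem continuous_opShift {ι : Type*} {g : ι → L2 d} (hg : Summable fun j => ‖g j‖ ^ 2)
    {S : L2 d →L[ℂ] L2 d} (hS : HasSum (fun j => rankOne ℂ (g j) (g j)) S) :
    Continuous fun z => opShift z S := by
  have h : (fun z => opShift z S)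
      = fun z => ∑' j, rankOne ℂ (tfShift z (g j)) (tfShift z (g j)) :=
    funext fun z => (hasSum_opShift z hS).tsum_eq.symm
  rw [h]
  refine continuous_tsum (fun j => ?_) hg fun j z => ?_
  · have h := continuous_tfShift_apply (g j)
    exact (smulRightL ℂ (L2 d) (L2 d)).continuous₂.comp
      (((innerSL ℂ).continuous.comp h).prodMk h)
  · rw [norm_rankOne, norm_tfShift_apply, pow_two]

theorem tr_comp_opShift {ι : Type*} {g : ι → L2 d} (hg : Summable fun j => ‖g j‖ ^ 2)
    {S : L2 d →L[ℂ] L2 d} (hS : HasSum (fun j => rankOne ℂ (g j) (g j)) S)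
    (T : L2 d →L[ℂ] L2 d) (z : Phase d) :
    tr (T ∘L opShift z S) = ∑' j, inner ℂ (tfShift z (g j)) (T (tfShift z (g j))) :=
  tr_comp_eq_tsum (summable_norm_sq_tfShift z hg) (hasSum_opShift z hS) T

theorem totalCorr_eq (S : L2 d →L[ℂ] L2 d) (z : Phase d) :
    totalCorr S z = tr (S ∘L opShift z S) := by
  rw [totalCorr, opConv, check_check]

theorem continuous_totalCorr {ι : Type*} {g : ι → L2 d} (hg : Summable fun j => ‖g j‖ ^ 2)
    {S : L2 d →L[ℂ] L2 d} (hS : HasSum (fun j => rankOne ℂ (g j) (g j)) S) :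
    Continuous (totalCorr S) := by
  have h : totalCorr S = fun z => ∑' j, inner ℂ (tfShift z (g j)) (S (tfShift z (g j))) :=
    funext fun z => by rw [totalCorr_eq, tr_comp_opShift hg hS]
  rw [h]
  refine continuous_tsum (fun j => ?_) (hg.mul_left ‖S‖) fun j z => ?_
  · have := continuous_tfShift_apply (g j)
    fun_prop
  · exact (norm_inner_apply_le S _).trans_eq (by rw [norm_tfShift_apply])

theorem tr_opShift_comp_opShift {ι : Type*} {g : ι → L2 d} (hg : Summable fun j => ‖g j‖ ^ 2)
    {S : L2 d →L[ℂ] L2 d} (hS : HasSum (fun j => rankOne ℂ (g j) (g j)) S) (z w : Phase d) :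
    tr (opShift z S ∘L opShift w S) = totalCorr S (w - z) := by
  rw [totalCorr_eq, tr_comp_opShift hg hS, tr_comp_opShift hg hS]
  exact tsum_congr fun j => inner_tfShift_opShift z w S (g j)

theorem locOp_eq {Ω : Set (Phase d)} (hΩ : MeasurableSet Ω) (S : L2 d →L[ℂ] L2 d) :
    locOp Ω S = ∫ z in Ω, opShift z S := by
  rw [locOp, funConv, ← integral_indicator hΩ]
  congr 1
  ext1 z
  by_cases hz : z ∈ Ω <;> simp [hz]

instance : TopologicalSpace.SeparableSpace (L2 d) :=
  have : Fact ((2 : ENNReal) ≠ ⊤) := ⟨by norm_num⟩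
  inferInstance

/-- For fixed trace class `S = ∑ⱼ gⱼ ⊗ gⱼ*`, the map `T ↦ tr (T S)` commutes with
Bochner integrals. -/
theorem tr_integral_comp {X : Type*} [MeasurableSpace X] {μ : Measure X} {ι : Type*} {g : ι → L2 d}
    (hg : Summable fun j => ‖g j‖ ^ 2) {S : L2 d →L[ℂ] L2 d}
    (hS : HasSum (fun j => rankOne ℂ (g j) (g j)) S) {B : X → L2 d →L[ℂ] L2 d} (hB : Integrable B μ) :
    tr ((∫ x, B x ∂μ) ∘L S) = ∫ x, tr (B x ∘L S) ∂μ := by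
  have hs : ∀ T : L2 d →L[ℂ] L2 d, Summable fun j => inner ℂ (g j) (T (g j)) := fun T =>
    .of_norm_bounded (hg.mul_left ‖T‖) fun j => norm_inner_apply_le T (g j)
  let Φ : (L2 d →L[ℂ] L2 d) →L[ℂ] ℂ := LinearMap.mkContinuous
    { toFun := fun T => ∑' j, inner ℂ (g j) (T (g j))
      map_add' := fun T U => by simp [inner_add_right, (hs T).tsum_add (hs U)]
      map_smul' := fun c T => by simp [inner_smul_right, tsum_mul_left] }
    (∑' j, ‖g j‖ ^ 2) fun T => by
      refine (tsum_of_norm_bounded (hg.mul_left ‖T‖).hasSum fun j =>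
        norm_inner_apply_le T (g j)).trans_eq ?_
      rw [tsum_mul_left, mul_comm]
  have hΦ : ∀ T, tr (T ∘L S) = Φ T := fun T => tr_comp_eq_tsum hg hS T
  simp only [hΦ]
  exact (Φ.integral_comp_comm hB).symm

/-- Termwise integration of the trace series. -/
theorem hasSum_inner_comp_integral {X : Type*}
    [MeasurableSpace X] {μ : Measure X} [IsFiniteMeasure μ] {κ : Type*} (b : HilbertBasis κ ℂ (L2 d))
    (T : L2 d →L[ℂ] L2 d) {B : X → L2 d →L[ℂ] L2 d} (hB : Integrable B μ) {C : ℝ}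
    (hC : ∀ x, ∀ s : Finset κ, ∑ i ∈ s, ‖inner ℂ (b i) (T (B x (b i)))‖ ≤ C) :
    HasSum (fun i => inner ℂ (b i) (T ((∫ x, B x ∂μ) (b i))))
      (∫ x, ∑' i, inner ℂ (b i) (T (B x (b i))) ∂μ) := by
  have : Countable κ := countable_of_orthonormal b.orthonormal
  let Ψ : κ → (L2 d →L[ℂ] L2 d) →L[ℂ] ℂ := fun i =>
    ((innerSL ℂ (b i)).comp T).comp (ContinuousLinearMap.apply ℂ (L2 d) (b i))
  have hint : ∀ i, Integrable (fun x => Ψ i (B x)) μ := fun i => (Ψ i).integrable_comp hB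
  -- The bound `C` on finite partial sums is uniform in `x`, hence integrable for a finite measure.
  have hsum : Summable fun i => ∫ x, ‖Ψ i (B x)‖ ∂μ := by
    refine summable_of_sum_le (c := ∫ _, C ∂μ)
      (fun i => integral_nonneg fun _ => norm_nonneg _) fun s => ?_
    rw [← integral_finsetSum _ fun i _ => (hint i).norm]
    exact integral_mono (integrable_finsetSum _ fun i _ => (hint i).norm) (integrable_const C)
      fun x => hC x s
  have h := hasSum_integral_of_summable_integral_norm hint hsum
  exact h.congr_fun fun i => ((Ψ i).integral_comp_comm hB).symm

open scoped ComplexOrder in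
theorem isPositive_integral {X : Type*} [MeasurableSpace X] {μ : Measure X}
    {B : X → L2 d →L[ℂ] L2 d} (hB : Integrable B μ) (hpos : ∀ x, (B x).IsPositive) :
    (∫ x, B x ∂μ).IsPositive := by
  rw [isPositive_iff_complex]
  intro f
  have h : inner ℂ f ((∫ x, B x ∂μ) f) = ∫ x, inner ℂ f (B x f) ∂μ :=
    (((innerSL ℂ f).comp (ContinuousLinearMap.apply ℂ (L2 d) f)).integral_comp_comm hB).symm
  have h0 : 0 ≤ inner ℂ f ((∫ x, B x ∂μ) f) := by
    rw [h]
    exact integral_nonneg fun x => (hpos x).inner_nonneg_right f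
  obtain ⟨hre, him⟩ := Complex.nonneg_iff.1 h0
  have hsymm : inner ℂ ((∫ x, B x ∂μ) f) f = inner ℂ f ((∫ x, B x ∂μ) f) := by
    rw [← inner_conj_symm, Complex.conj_eq_iff_im, ← him]
  rw [hsymm]
  exact ⟨Complex.ext rfl him, hre⟩

theorem integrableOn_opShift {Ω : Set (Phase d)} (hΩ : IsCompact Ω) {ι : Type*} {g : ι → L2 d}
    (hg : Summable fun j => ‖g j‖ ^ 2) {S : L2 d →L[ℂ] L2 d}
    (hS : HasSum (fun j => rankOne ℂ (g j) (g j)) S) :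
    IntegrableOn (fun z => opShift z S) Ω :=
  (continuous_opShift hg hS).continuousOn.integrableOn_compact hΩ

/-- The trace of `T (χ_Ω ⋆ S)`, computed in an arbitrary orthonormal basis. -/
theorem hasSum_inner_comp_locOp {Ω : Set (Phase d)} (hΩ : IsCompact Ω) {ι κ : Type*}
    (b : HilbertBasis κ ℂ (L2 d)) {g : ι → L2 d} (hg : Summable fun j => ‖g j‖ ^ 2)
    {S : L2 d →L[ℂ] L2 d} (hS : HasSum (fun j => rankOne ℂ (g j) (g j)) S)
    (T : L2 d →L[ℂ] L2 d) :
    HasSum (fun i => inner ℂ (b i) (T (locOp Ω S (b i)))) (∫ z in Ω, tr (T ∘L opShift z S)) := by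
  have : IsFiniteMeasure (volume.restrict Ω) := isFiniteMeasure_restrict.2 hΩ.measure_lt_top.ne
  have hz := fun z => hasSum_inner_comp b (summable_norm_sq_tfShift z hg) (hasSum_opShift z hS) T
  have htr : ∀ z, ∑' i, inner ℂ (b i) (T (opShift z S (b i))) = tr (T ∘L opShift z S) := fun z =>
    (hz z).1.tsum_eq.trans (tr_comp_opShift hg hS T z).symm
  -- Removes `z` from the bound on partial sums, as uniformity requires.
  simp only [norm_tfShift_apply] at hz
  rw [locOp_eq hΩ.measurableSet]
  have h := hasSum_inner_comp_integral b T (integrableOn_opShift hΩ hg hS) fun z => (hz z).2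
  simpa only [htr] using h

theorem tr_comp_locOp {Ω : Set (Phase d)} (hΩ : IsCompact Ω) {ι : Type*}
    {g : ι → L2 d} (hg : Summable fun j => ‖g j‖ ^ 2)
    {S : L2 d →L[ℂ] L2 d} (hS : HasSum (fun j => rankOne ℂ (g j) (g j)) S)
    (T : L2 d →L[ℂ] L2 d) :
    tr (T ∘L locOp Ω S) = ∫ z in Ω, tr (T ∘L opShift z S) :=
  (hasSum_inner_comp_locOp hΩ (stdBasis (L2 d)) hg hS T).tsum_eq

theorem tr_locOp {Ω : Set (Phase d)} (hΩ : IsCompact Ω) {ι : Type*}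
    {g : ι → L2 d} (hg : Summable fun j => ‖g j‖ ^ 2)
    {S : L2 d →L[ℂ] L2 d} (hS : HasSum (fun j => rankOne ℂ (g j) (g j)) S) :
    tr (locOp Ω S) = volume.real Ω * tr S := by
  have h : ∀ z, tr (opShift z S) = tr S := fun z => by
    have h1 := tr_comp_opShift hg hS (ContinuousLinearMap.id ℂ (L2 d)) z
    have h2 := tr_comp_eq_tsum hg hS (ContinuousLinearMap.id ℂ (L2 d))
    simp only [id_comp, coe_id', id_eq, inner_tfShift_tfShift] at h1 h2
    rw [h1, h2]
  have h1 := tr_comp_locOp hΩ hg hS (ContinuousLinearMap.id ℂ (L2 d))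
  simp only [id_comp, h] at h1
  rw [h1, setIntegral_const, Complex.real_smul]

/-- The factors are expanded one at a time: the right one by `tr_comp_locOp`, then the left one
against the trace class operator `α_w(S)`. Fubini puts the integral over `w` inside, ready for
translation to `Ω - z`. -/
theorem tr_locOp_comp_locOp {Ω : Set (Phase d)} (hΩ : IsCompact Ω) {ι : Type*}
    {g : ι → L2 d} (hg : Summable fun j => ‖g j‖ ^ 2)
    {S : L2 d →L[ℂ] L2 d} (hS : HasSum (fun j => rankOne ℂ (g j) (g j)) S) :
    tr (locOp Ω S ∘L locOp Ω S) = ∫ z in Ω, ∫ w in Ω, totalCorr S (w - z) := by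
  have h : ∀ w, tr (locOp Ω S ∘L opShift w S) = ∫ z in Ω, totalCorr S (w - z) := fun w => by
    rw [locOp_eq hΩ.measurableSet, tr_integral_comp (summable_norm_sq_tfShift w hg)
      (hasSum_opShift w hS) (integrableOn_opShift hΩ hg hS)]
    exact integral_congr_ae (.of_forall fun z => tr_opShift_comp_opShift hg hS z w)
  rw [tr_comp_locOp hΩ hg hS]
  simp only [h]
  refine integral_integral_swap ?_
  rw [Measure.prod_restrict]
  have hc := continuous_totalCorr hg hS
  have hc' : Continuous (Function.uncurry fun w z : Phase d => totalCorr S (w - z)) :=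
    hc.comp (continuous_fst.sub continuous_snd)
  exact hc'.continuousOn.integrableOn_compact (hΩ.prod hΩ)

instance : (volume : Measure (Phase d)).IsAddLeftInvariant :=
  inferInstanceAs ((volume : Measure (Space d)).prod volume).IsAddLeftInvariant

theorem setIntegral_shiftSet (F : Phase d → ℂ) (Ω : Set (Phase d)) (z : Phase d) :
    ∫ w in shiftSet Ω z, F w = ∫ w in Ω, F (w - z) :=
  (measurePreserving_sub_right volume z).setIntegral_image_emb
    (MeasurableEquiv.subRight z).measurableEmbedding F Ω

theorem continuous_lackConc {F : Phase d → ℂ} (hF : Continuous F) {Ω : Set (Phase d)}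
    (hΩ : IsCompact Ω) : Continuous (lackConc F Ω) := by
  -- Translation moves the dependence on `z` from the domain to the integrand.
  have h : lackConc F Ω = fun z => 1 - ∫ w in Ω, F (w - z) :=
    funext fun z => by rw [lackConc, setIntegral_shiftSet]
  rw [h]
  refine continuous_const.sub
    (continuous_parametric_integral_of_continuous (f := fun z w => F (w - z)) ?_ hΩ)
  exact hF.comp (continuous_snd.sub continuous_fst)

end TimeFrequency
end QHA

theorem mainTheorem6 (d : ℕ) (Ω : Set (Phase d)) (hΩ : IsCompact Ω)
    (S : L2 d →L[ℂ] L2 d) (hpos : S.IsPositive) (hS : IsTraceClass S) (htr : tr S = 1) :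
    IntegrableOn (fun z => opShift z S) Ω ∧
    IsTraceClass (locOp Ω S) ∧
    IsTraceClass (locOp Ω S ∘L locOp Ω S) ∧
    (∀ z, IntegrableOn (totalCorr S) (shiftSet Ω z)) ∧
    IntegrableOn (lackConc (totalCorr S) Ω) Ω ∧
    projFunctional (locOp Ω S) = ∫ z in Ω, (1 - ∫ z' in shiftSet Ω z, totalCorr S z') ∧
    (volume Ω ≠ 0 →
      ALC (totalCorr S) Ω = projFunctional (locOp Ω S) / (volume.real Ω : ℂ)) := by
  obtain ⟨g, hg, hSg⟩ := exists_rankOne_decomposition hpos hS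
  have hcorr := continuous_totalCorr hg hSg
  have hint := integrableOn_opShift hΩ hg hSg
  have hlack : IntegrableOn (lackConc (totalCorr S) Ω) Ω :=
    (continuous_lackConc hcorr hΩ).continuousOn.integrableOn_compact hΩ
  have hA : (locOp Ω S).IsPositive := by
    rw [locOp_eq hΩ.measurableSet]
    exact isPositive_integral hint fun z => opShift_isPositive z hpos
  have hA2 : (locOp Ω S ∘L locOp Ω S).IsPositive := by
    have h := ContinuousLinearMap.isPositive_adjoint_comp_self (locOp Ω S)
    rwa [hA.isSelfAdjoint.adjoint_eq] at h
  have hmain : projFunctional (locOp Ω S) = ∫ z in Ω, lackConc (totalCorr S) Ω z := by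
    have h1 : IntegrableOn (fun _ : Phase d => (1 : ℂ)) Ω :=
      continuousOn_const.integrableOn_compact hΩ
    -- The inner integral is `1` minus the lack of concentration, so it inherits integrability.
    have h2 : IntegrableOn (fun z => ∫ w in shiftSet Ω z, totalCorr S w) Ω :=
      (h1.sub hlack).congr (.of_forall fun z => by simp [lackConc])
    simp only [lackConc]
    rw [integral_sub h1 h2, projFunctional, tr_locOp hΩ hg hSg, htr,
      tr_locOp_comp_locOp hΩ hg hSg, setIntegral_const, Complex.real_smul]
    simp only [setIntegral_shiftSet]
  refine ⟨hint, isTraceClass_of_isPositive hA fun ι e => ?_,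
    isTraceClass_of_isPositive hA2 fun ι e => ?_, fun z => ?_, hlack, hmain, fun _ => ?_⟩
  · exact (hasSum_inner_comp_locOp hΩ e hg hSg (ContinuousLinearMap.id ℂ (L2 d))).summable
  · exact (hasSum_inner_comp_locOp hΩ e hg hSg (locOp Ω S)).summable
  · exact hcorr.continuousOn.integrableOn_compact (hΩ.image (continuous_sub_right z))
  · rw [ALC, hmain, one_div, div_eq_inv_mul]
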